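/- Write $\mathcal{H}^1$ for one-dimensional Hausdorff measure (length) and $\lambda^d$ for Lebesgue measure on $\mathbb{R}^d$. A set $A\subset\mathbb{R}^2$ is called rectifiable if it can be covered by countably many Lipschitz curves and an $\mathcal{H}^1$-null set. For a unit vector $\theta\in S^1$ and a set $E\subset\mathbb{R}^2$ let $(R_\theta\chi_E)(r)=\lambda^1(E\cap\{x\in\mathbb{R}^2:\langle x,\theta\rangle=r\})$ for $r\in\mathbb{R}$, the Radon transform of $\chi_E$ in direction $\theta$. An element of a family $\mathcal{A}$ of Lebesgue measurable subsets of $\mathbb{R}^2$ of finite measure can be reconstructed using $n$ test sets if there exist Lebesgue measurable sets $T_1,\dots,T_n\subset\mathbb{R}^2$ such that whenever $A,B\in\mathcal{A}$ and $\lambda^2(A\cap T_i)=\lambda^2(B\cap T_i)$ for every $i=1,\dots,n$, then $A=B$. (1) Let $K\subset\mathbb{R}^2$ be a compact set whose boundary $\partial K$ is rectifiable and satisfies $\mathcal{H}^1(\partial K)<\infty$. Then the function $R_\theta\chi_K:\mathbb{R}\to\mathbb{R}$ is absolutely continuous for all but countably many $\theta\in S^1$. (2) Let $E\subset\mathbb{R}^2$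 be a bounded Lebesgue measurable set with $\lambda^2(E)>0$ whose boundary $\partial E$ is rectifiable and satisfies $\mathcal{H}^1(\partial E)<\infty$. Then a translate of $E$ can be reconstructed using $2$ test sets; that is, an element of the family $\{E+v: v\in\mathbb{R}^2\}$ can be reconstructed using $2$ test sets. -/

import Mathlib

/-- The Euclidean plane. -/
abbrev Plane : Type := EuclideanSpace ℝ (Fin 2)

/-- The vector `θ` rotated by a right angle. -/
noncomputable def perp (θ : Plane) : Plane := !₂[-(θ 1), θ 0]

/-- The Radon transform `(R_θ χ_E)(r)`, for a unit vector `θ`: the Lebesgue measure of the section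
of `E` by the line `{x | ⟨x, θ⟩ = r}`. The line carries its arc-length coordinate
`s ↦ r θ + s θ^⊥`. -/
noncomputable def radonTransform (E : Set Plane) (θ : Plane) (r : ℝ) : ℝ :=
  (MeasureTheory.volume {s : ℝ | r • θ + s • perp θ ∈ E}).toReal

/-- The coordinate used in `radonTransform` runs through exactly the line `⟨x, θ⟩ = r`. -/
theorem inner_eq_iff_exists_perp (θ : Plane) (hθ : ‖θ‖ = 1) (r : ℝ) (x : Plane) :
    inner ℝ x θ = r ↔ ∃ s : ℝ, x = r • θ + s • perp θ := by
  have h1 : θ 0 ^ 2 + θ 1 ^ 2 = 1 := by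
    have h := EuclideanSpace.norm_sq_eq θ
    rw [hθ, Fin.sum_univ_two] at h
    simpa using h.symm
  have h2 : inner ℝ x θ = x 0 * θ 0 + x 1 * θ 1 := by
    rw [PiLp.inner_apply, Fin.sum_univ_two]
    simp [mul_comm]
  rw [h2]
  constructor
  · intro h
    refine ⟨x 1 * θ 0 - x 0 * θ 1, ?_⟩
    ext i
    fin_cases i
    · simp [perp]
      linear_combination (-(x 0)) * h1 + θ 0 * h
    · simp [perp]
      linear_combination (-(x 1)) * h1 + θ 1 * h
  · rintro ⟨s, rfl⟩
    simp [perp]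
    linear_combination r * h1

/-- Absolute continuity of a function on the whole real line: for every `ε > 0` there is `δ > 0`
such that for every finite system of non-overlapping intervals `[x j, y j]` of total length less
than `δ`, the sum of the increments `|f (y j) - f (x j)|` is less than `ε`. -/
def IsAbsolutelyContinuous (f : ℝ → ℝ) : Prop :=
  ∀ ε : ℝ, 0 < ε → ∃ δ : ℝ, 0 < δ ∧
    ∀ (n : ℕ) (x y : Fin n → ℝ), (∀ j, x j ≤ y j) →
      Pairwise (fun i j => Disjoint (Set.Ioc (x i) (y i)) (Set.Ioc (x j) (y j))) →
      ∑ j, (y j - x j) < δ → ∑ j, |f (y j) - f (x j)| < ε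

/-- A planar set is rectifiable if it can be covered by countably many Lipschitz curves (Lipschitz
images of `[0, 1]`) and a set of one-dimensional Hausdorff measure zero. -/
def IsRectifiable (A : Set Plane) : Prop :=
  ∃ γ : ℕ → ℝ → Plane,
    (∀ i, ∃ L : NNReal, LipschitzOnWith L (γ i) (Set.Icc 0 1)) ∧
    MeasureTheory.Measure.hausdorffMeasure 1 (A \ ⋃ i, γ i '' Set.Icc 0 1) = 0

/-- An element of the family `𝒜` can be reconstructed using `n` test sets: there are Lebesgue
measurable sets `T 1, …, T n` such that the Lebesgue measures of `A ∩ T i` determine the member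
`A` of the family. -/
def CanReconstruct {d : ℕ} (𝒜 : Set (Set (EuclideanSpace ℝ (Fin d)))) (n : ℕ) : Prop :=
  ∃ T : Fin n → Set (EuclideanSpace ℝ (Fin d)),
    (∀ i, MeasureTheory.NullMeasurableSet (T i) MeasureTheory.volume) ∧
    ∀ A ∈ 𝒜, ∀ B ∈ 𝒜,
      (∀ i, MeasureTheory.volume (A ∩ T i) = MeasureTheory.volume (B ∩ T i)) → A = B

/-- The family of all translates of a set. -/
def translates {d : ℕ} (E : Set (EuclideanSpace ℝ (Fin d))) :
    Set (Set (EuclideanSpace ℝ (Fin d))) :=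
  {A | ∃ v : EuclideanSpace ℝ (Fin d), A = (fun x => x + v) '' E}

open MeasureTheory Set

/-! Let `f` be the Radon transform of `E` in direction `θ`. If a point of one section faces a point
outside `E` in a parallel section, the segment joining them meets the frontier. Hence `|f b - f a|`
is at most the length of the frontier in the strip `a ≤ ⟨x, θ⟩ ≤ b`, and `f` is absolutely
continuous once the image of frontier length under `⟨·, θ⟩` is an absolutely continuous measure. On
a Lipschitz curve this can fail only if the derivative is nonzero and orthogonal to `θ` on a
parameter set of positive measure. Such sets are disjoint for directions that differ by more than a
sign, so only countably many directions are bad.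

For reconstruction, take `θ` with both `θ` and `perp θ` good, and strips `⟨x, θ⟩ ∈ S` as test sets.
The strip meets `E + v` in measure `∫ r in S, f (r - s)` with `s = ⟨v, θ⟩`, so `S` must make this
injective in `s`. If `S` were a weight equal to `w m` on `[m, m + 1)`, with `w` strictly increasing,
the derivative in `s` would be `-∑ w m (f (m + 1 - s) - f (m - s)) = ∑ (w m - w (m - 1)) f (m - s)`,
which is positive once `f` is scaled to be bounded below on a unit interval. A fine periodic pattern
of density `w m` in each cell imitates this weight. As `f'` is integrable, the error is small
uniformly in `s` and can be kept below the gain (`exists_setIntegral_deriv_neg`). -/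

/-! ### Derivatives, null sets and length -/

/-- A one-dimensional Sard lemma: the image of a set of critical points of a curve has length
zero. -/
theorem hausdorffMeasure_image_eq_zero_of_hasDerivAt_zero {E : Type*} [NormedAddCommGroup E]
    [NormedSpace ℝ E] [MeasurableSpace E] [BorelSpace E] [SecondCountableTopology E]
    {γ : ℝ → E} {s : Set ℝ} (hs : volume s ≠ ⊤) (h : ∀ t ∈ s, HasDerivAt γ 0 t) :
    Measure.hausdorffMeasure 1 (γ '' s) = 0 := by
  have key : ∀ ε : NNReal, 0 < ε →
      Measure.hausdorffMeasure 1 (γ '' s) ≤ (ε : ENNReal) * volume s := by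
    intro ε hε
    -- On each piece `γ` is within slope `ε` of the zero map, that is, `ε`-Lipschitz.
    obtain ⟨t, A, hd, hm, hst, hA, hAf⟩ :=
      exists_partition_approximatesLinearOn_of_hasFDerivWithinAt γ s (fun _ => 0)
        (fun x hx => by simpa using (h x hx).hasFDerivAt.hasFDerivWithinAt)
        (fun _ => ε) (fun _ => hε.ne')
    rcases s.eq_empty_or_nonempty with rfl | hne
    · simp
    have hL : ∀ n, LipschitzOnWith ε γ (s ∩ t n) := by
      intro n
      obtain ⟨y, -, hy⟩ := hAf hne n
      have := hA n
      rw [hy] at this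
      exact LipschitzOnWith.of_dist_le_mul fun x hx z hz => by
        simpa [dist_eq_norm] using this x hx z hz
    have hcov : γ '' s ⊆ ⋃ n, γ '' (s ∩ t n) := by
      rw [← image_iUnion, ← inter_iUnion, inter_eq_left.2 hst]
    calc Measure.hausdorffMeasure 1 (γ '' s)
        ≤ ∑' n, Measure.hausdorffMeasure 1 (γ '' (s ∩ t n)) :=
          (measure_mono hcov).trans (measure_iUnion_le _)
      _ ≤ ∑' n, (ε : ENNReal) * volume (s ∩ t n) := by
          refine ENNReal.tsum_le_tsum fun n => ?_
          simpa [hausdorffMeasure_real] using (hL n).hausdorffMeasure_image_le zero_le_one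
      _ = (ε : ENNReal) * volume.restrict s (⋃ n, t n) := by
          rw [ENNReal.tsum_mul_left, measure_iUnion hd hm]
          simp_rw [Measure.restrict_apply (hm _), inter_comm]
      _ ≤ (ε : ENNReal) * volume s := by
          exact mul_le_mul' le_rfl
            ((measure_mono (subset_univ _)).trans (Measure.restrict_apply_univ s).le)
  refine nonpos_iff_eq_zero.1 (ENNReal.le_of_forall_pos_le_add fun ε hε _ => ?_)
  lift volume s to NNReal using hs with v
  refine (key (ε / (v + 1)) (by positivity)).trans ?_
  rw [zero_add, ← ENNReal.coe_mul, ENNReal.coe_le_coe, div_mul_eq_mul_div]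
  exact div_le_of_le_mul₀ (by positivity) (by positivity) (by gcongr; simp)

/-- If a real function has nonzero derivative at all points of `s` and maps `s` into a null set,
then `s` is a null set. -/
theorem volume_eq_zero_of_image_subset_null {h h' : ℝ → ℝ} {s N : Set ℝ} (hN : volume N = 0)
    (hs : ∀ t ∈ s, h t ∈ N) (hd : ∀ t ∈ s, HasDerivAt h (h' t) t) (h0 : ∀ t ∈ s, h' t ≠ 0) :
    volume s = 0 := by
  rcases s.eq_empty_or_nonempty with rfl | hne
  · simp
  obtain ⟨t, A, -, -, hst, hA, hAf⟩ :=
    exists_partition_approximatesLinearOn_of_hasFDerivWithinAt h s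
      (fun x => ContinuousLinearMap.toSpanSingleton ℝ (h' x))
      (fun x hx => (hd x hx).hasFDerivAt.hasFDerivWithinAt)
      -- An error of half the slope leaves `h` expanding by at least half the slope on each piece.
      -- The value `1` is a dummy: slope zero does not occur.
      (fun A => if A 1 = 0 then 1 else ‖A 1‖₊ / 2) (fun A => by
        split_ifs with hA1
        · exact one_ne_zero
        · simpa using hA1)
  have hn : ∀ n, volume (s ∩ t n) = 0 := by
    intro n
    obtain ⟨y, hy, hAy⟩ := hAf hne n
    have hA1 : A n 1 = h' y := by simp [hAy]
    have hA1' : A n 1 ≠ 0 := hA1 ▸ h0 y hy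
    have hpos : 0 < ‖A n 1‖₊ / 2 := by simpa [pos_iff_ne_zero] using hA1'
    have hanti : AntilipschitzWith (‖A n 1‖₊ / 2)⁻¹ (fun x : ↥(s ∩ t n) => h x) := by
      refine AntilipschitzWith.of_le_mul_dist fun x z => ?_
      have := hA n x x.2 z z.2
      simp only [hA1', if_false] at this
      have e : A n ((x : ℝ) - z) = ((x : ℝ) - z) * A n 1 := by
        rw [← smul_eq_mul, ← map_smul]; simp
      rw [e] at this
      have h3 : ‖((x : ℝ) - z) * A n 1‖ ≤ ‖h x - h z‖ + ‖h x - h z - ((x : ℝ) - z) * A n 1‖ := by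
        have := norm_sub_le (h x - h z) (h x - h z - ((x : ℝ) - z) * A n 1)
        simpa using this
      rw [norm_mul] at h3
      push_cast at this ⊢
      rw [Subtype.dist_eq, dist_eq_norm, dist_eq_norm, inv_mul_eq_div, le_div_iff₀]
      · linarith
      · exact_mod_cast hpos
    have := hanti.le_hausdorffMeasure_image (d := 1) zero_le_one univ
    have him : (fun x : ↥(s ∩ t n) => h x) '' univ ⊆ N := by
      rintro _ ⟨x, -, rfl⟩
      exact hs x x.2.1
    have h0' : Measure.hausdorffMeasure 1 ((fun x : ↥(s ∩ t n) => h x) '' univ) = 0 := by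
      rw [hausdorffMeasure_real]
      exact measure_mono_null him hN
    rw [h0', mul_zero, nonpos_iff_eq_zero] at this
    rw [← isometry_subtype_coe.hausdorffMeasure_image (Or.inl zero_le_one) univ] at this
    simpa [hausdorffMeasure_real] using this
  have : s ⊆ ⋃ n, s ∩ t n := by rw [← inter_iUnion, inter_eq_left.2 hst]
  exact measure_mono_null this (measure_iUnion_null hn)

/-! ### Exceptional directions of curves and rectifiable sets -/

theorem inner_eq_coords (x θ : Plane) : inner ℝ x θ = x 0 * θ 0 + x 1 * θ 1 := by
  rw [PiLp.inner_apply, Fin.sum_univ_two]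
  simp [mul_comm]

theorem norm_eq_one_iff_coords (θ : Plane) : ‖θ‖ = 1 ↔ θ 0 ^ 2 + θ 1 ^ 2 = 1 := by
  have h := EuclideanSpace.norm_sq_eq θ
  rw [Fin.sum_univ_two] at h
  simp only [Real.norm_eq_abs, sq_abs] at h
  rw [← h, pow_eq_one_iff_of_nonneg (norm_nonneg θ) two_ne_zero]

/-- Unit vectors orthogonal to a common nonzero vector of the plane agree up to sign. -/
theorem eq_or_eq_neg_of_inner_eq_zero {u θ η : Plane} (hu : u ≠ 0) (hθ : ‖θ‖ = 1) (hη : ‖η‖ = 1)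
    (h1 : inner ℝ u θ = 0) (h2 : inner ℝ u η = 0) : θ = η ∨ θ = -η := by
  rw [norm_eq_one_iff_coords] at hθ hη
  rw [inner_eq_coords] at h1 h2
  have hu' : u 0 ≠ 0 ∨ u 1 ≠ 0 := by
    by_contra! hc
    exact hu (by ext i; fin_cases i <;> simp [hc])
  have hdet : θ 0 * η 1 = θ 1 * η 0 := by
    rcases hu' with h | h
    · exact mul_left_cancel₀ h (by linear_combination η 1 * h1 - θ 1 * h2)
    · exact mul_left_cancel₀ h (by linear_combination -(η 0) * h1 + θ 0 * h2)
  -- Lagrange's identity: the squares of dot product and determinant add up to `1`.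
  have hdot : (θ 0 * η 0 + θ 1 * η 1 - 1) * (θ 0 * η 0 + θ 1 * η 1 + 1) = 0 := by
    linear_combination (η 0 ^ 2 + η 1 ^ 2) * hθ + hη - (θ 0 * η 1 - θ 1 * η 0) * hdet
  rcases mul_eq_zero.1 hdot with h | h
  · left
    have : (θ 0 - η 0) ^ 2 + (θ 1 - η 1) ^ 2 = 0 := by linear_combination hθ + hη - 2 * h
    ext i
    fin_cases i <;> simp <;> nlinarith [sq_nonneg (θ 0 - η 0), sq_nonneg (θ 1 - η 1)]
  · right
    have : (θ 0 + η 0) ^ 2 + (θ 1 + η 1) ^ 2 = 0 := by linear_combination hθ + hη + 2 * h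
    ext i
    fin_cases i <;> simp <;> nlinarith [sq_nonneg (θ 0 + η 0), sq_nonneg (θ 1 + η 1)]

/-- Nonzero vectors of a measurable vector field are orthogonal to a given direction on a null set
only, apart from countably many directions. -/
theorem countable_setOf_volume_orthogonal_ne_zero {u : ℝ → Plane} (hu : Measurable u) :
    Set.Countable {θ : Plane | ‖θ‖ = 1 ∧ volume {t | u t ≠ 0 ∧ inner ℝ (u t) θ = 0} ≠ 0} := by
  let T : Plane → Set ℝ := fun θ => {t | u t ≠ 0 ∧ inner ℝ (u t) θ = 0}
  -- A half-open half circle, with one representative of each pair `±θ`; over it the sets `T θ` are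
  -- disjoint.
  let H : Set Plane := {θ | ‖θ‖ = 1 ∧ (0 < θ 0 ∨ θ 0 = 0 ∧ 0 < θ 1)}
  have hTm : ∀ θ, MeasurableSet (T θ) := fun θ =>
    (hu (measurableSet_singleton 0)).compl.inter
      ((hu.inner measurable_const) (measurableSet_singleton 0))
  have hdisj : Pairwise (Function.onFun Disjoint (fun θ : H => T θ)) := by
    rintro ⟨θ, hθ, hθ'⟩ ⟨η, hη, hη'⟩ hne
    refine Set.disjoint_left.2 fun t ht ht' => ?_
    rcases eq_or_eq_neg_of_inner_eq_zero ht.1 hθ hη ht.2 ht'.2 with h | h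
    · exact hne (Subtype.ext h)
    · have e0 : θ 0 = -η 0 := by rw [h]; simp
      have e1 : θ 1 = -η 1 := by rw [h]; simp
      rcases hθ' with a | ⟨a, a'⟩ <;> rcases hη' with b | ⟨b, b'⟩ <;> linarith
  have hc := (Measure.countable_meas_pos_of_disjoint_iUnion (μ := volume)
    (fun θ : H => hTm θ) hdisj).image ((↑) : H → Plane)
  refine (hc.union (hc.image (fun θ => -θ))).mono ?_
  rintro θ ⟨hθ, hpos⟩
  have hTneg : T (-θ) = T θ := by ext t; simp [T]
  have hcase : θ ∈ H ∨ -θ ∈ H := by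
    have h1 := (norm_eq_one_iff_coords θ).1 hθ
    simp only [H, Set.mem_ofPred_eq, norm_neg, hθ, true_and, PiLp.neg_apply]
    rcases lt_trichotomy (θ 0) 0 with h | h | h
    · right; left; linarith
    · rw [h] at h1
      rcases lt_trichotomy (θ 1) 0 with h' | h' | h'
      · right; right; constructor <;> linarith
      · rw [h'] at h1; norm_num at h1
      · left; right; exact ⟨h, h'⟩
    · left; left; exact h
  rcases hcase with h | h
  · exact Or.inl ⟨⟨θ, h⟩, pos_iff_ne_zero.2 hpos, rfl⟩
  · refine Or.inr ⟨-θ, ⟨⟨-θ, h⟩, ?_, rfl⟩, neg_neg θ⟩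
    change 0 < volume (T (-θ))
    rw [hTneg]
    exact pos_iff_ne_zero.2 hpos

/-- For all but countably many directions, the part of a Lipschitz curve lying over a null set of
the axis in that direction has length zero. -/
theorem LipschitzWith.countable_exceptional_directions {L : NNReal} {γ : ℝ → Plane}
    (hγ : LipschitzWith L γ) :
    Set.Countable {θ : Plane | ‖θ‖ = 1 ∧ ¬ ∀ N : Set ℝ, volume N = 0 →
      Measure.hausdorffMeasure 1 (γ '' Icc 0 1 ∩ {x | inner ℝ x θ ∈ N}) = 0} := by
  refine (countable_setOf_volume_orthogonal_ne_zero (measurable_deriv γ)).mono ?_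
  rintro θ ⟨hθ, hN⟩
  refine ⟨hθ, fun hT => hN fun N hN0 => ?_⟩
  have himage : ∀ s : Set ℝ, volume s = 0 → Measure.hausdorffMeasure 1 (γ '' s) = 0 := by
    intro s hs
    have := hγ.hausdorffMeasure_image_le (d := 1) zero_le_one s
    rw [hausdorffMeasure_real, hs, mul_zero] at this
    exact nonpos_iff_eq_zero.1 this
  let D : Set ℝ := {t | DifferentiableAt ℝ γ t}
  have hD : volume Dᶜ = 0 := hγ.ae_differentiableAt_real
  let Z : Set ℝ := {t ∈ Icc (0 : ℝ) 1 | DifferentiableAt ℝ γ t ∧ deriv γ t = 0}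
  let M : Set ℝ := {t | inner ℝ (γ t) θ ∈ N ∧ DifferentiableAt ℝ γ t ∧
    inner ℝ (deriv γ t) θ ≠ 0}
  have hM : volume M = 0 :=
    volume_eq_zero_of_image_subset_null (h := fun t => inner ℝ (γ t) θ)
      (h' := fun t => inner ℝ (deriv γ t) θ) hN0 (fun t ht => ht.1)
      (fun t ht => by simpa using ht.2.1.hasDerivAt.inner ℝ (hasDerivAt_const t θ))
      (fun t ht => ht.2.2)
  have hZ : Measure.hausdorffMeasure 1 (γ '' Z) = 0 := by
    refine hausdorffMeasure_image_eq_zero_of_hasDerivAt_zero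
      (measure_ne_top_of_subset (sep_subset _ _) (by simp)) ?_
    rintro t ⟨-, hd, h0⟩
    exact h0 ▸ hd.hasDerivAt
  -- Four kinds of parameters: non-differentiability (Rademacher), critical points (Sard),
  -- derivative transverse to the lines `⟨x, θ⟩ = r` (null since `N` is), and nonzero derivative
  -- along them (null by the choice of `θ`).
  refine measure_mono_null (t := γ '' Dᶜ ∪ γ '' Z ∪ γ '' M ∪
    γ '' {t | deriv γ t ≠ 0 ∧ inner ℝ (deriv γ t) θ = 0}) ?_ ?_
  · rintro _ ⟨⟨t, ht, rfl⟩, htN⟩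
    by_cases h1 : DifferentiableAt ℝ γ t
    · by_cases h2 : deriv γ t = 0
      · exact Or.inl (Or.inl (Or.inr ⟨t, ⟨ht, h1, h2⟩, rfl⟩))
      · by_cases h3 : inner ℝ (deriv γ t) θ = 0
        · exact Or.inr ⟨t, ⟨h2, h3⟩, rfl⟩
        · exact Or.inl (Or.inr ⟨t, ⟨htN, h1, h3⟩, rfl⟩)
    · exact Or.inl (Or.inl (Or.inl ⟨t, h1, rfl⟩))
  · simp only [measure_union_null_iff]
    exact ⟨⟨⟨himage _ hD, hZ⟩, himage _ hM⟩, himage _ hT⟩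

/-- For all but countably many directions, the part of a rectifiable set lying over a null set of
the axis in that direction has length zero. -/
theorem IsRectifiable.countable_exceptional_directions {A : Set Plane} (hA : IsRectifiable A) :
    Set.Countable {θ : Plane | ‖θ‖ = 1 ∧ ¬ ∀ N : Set ℝ, volume N = 0 →
      Measure.hausdorffMeasure 1 (A ∩ {x | inner ℝ x θ ∈ N}) = 0} := by
  obtain ⟨γ, hγ, hnull⟩ := hA
  choose L hL using hγ
  -- Extending each curve to the whole line makes two-sided derivatives available.
  choose g hg hgγ using fun i => (hL i).extend_finite_dimension
  refine (countable_iUnion fun i => (hg i).countable_exceptional_directions).mono ?_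
  rintro θ ⟨hθ, hN⟩
  by_contra hcon
  simp only [mem_iUnion, not_exists] at hcon
  refine hN fun N hN0 => ?_
  have hi : ∀ i, Measure.hausdorffMeasure 1
      (γ i '' Icc 0 1 ∩ {x | inner ℝ x θ ∈ N}) = 0 := by
    intro i
    rw [(hgγ i).image_eq]
    by_contra hne
    exact hcon i ⟨hθ, fun hall => hne (hall N hN0)⟩
  refine measure_mono_null (t := (A \ ⋃ i, γ i '' Icc 0 1) ∪
    ⋃ i, γ i '' Icc 0 1 ∩ {x | inner ℝ x θ ∈ N}) ?_
    (measure_union_null hnull (measure_iUnion_null hi))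
  rintro x ⟨hx, hxN⟩
  by_cases h : x ∈ ⋃ i, γ i '' Icc 0 1
  · right
    rw [← iUnion_inter]
    exact ⟨h, hxN⟩
  · exact Or.inl ⟨hx, h⟩

/-! ### Absolute continuity -/

/-- A function whose increments are dominated by a finite measure which is absolutely continuous
with respect to Lebesgue measure is absolutely continuous. -/
theorem isAbsolutelyContinuous_of_measure {f : ℝ → ℝ} {ν : Measure ℝ} [IsFiniteMeasure ν]
    (hν : ν ≪ volume) (h : ∀ a b, a ≤ b → |f b - f a| ≤ ν.real (Icc a b)) :
    IsAbsolutelyContinuous f := by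
  intro ε hε
  obtain ⟨δ, hδ, hνδ⟩ : ∃ δ > 0, ∀ s, volume s < δ → MeasurableSet s →
      ν s < ENNReal.ofReal ε := by
    -- The `ε`-`δ` form comes from the integrability of the density of `ν`.
    obtain ⟨δ, hδ, H⟩ := exists_pos_setLIntegral_lt_of_measure_lt
      (μ := volume) (f := ν.rnDeriv volume) (Measure.lintegral_rnDeriv_lt_top ν volume).ne
      (ENNReal.ofReal_pos.2 hε).ne'
    refine ⟨δ, hδ, fun s hs hsm => ?_⟩
    rw [← Measure.setLIntegral_rnDeriv hν]
    exact H s hs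
  obtain ⟨δ', hδ'0, hδ'⟩ : ∃ δ' : ℝ, 0 < δ' ∧ ENNReal.ofReal δ' ≤ δ := by
    rcases eq_or_ne δ ⊤ with rfl | hne
    · exact ⟨1, one_pos, le_top⟩
    · exact ⟨δ.toReal, ENNReal.toReal_pos hδ.ne' hne, (ENNReal.ofReal_toReal hne).le⟩
  refine ⟨δ', hδ'0, fun n x y hxy hdisj hsum => ?_⟩
  -- Increments are bounded over closed intervals but only the half-open ones are disjoint;
  -- endpoints carry no `ν`-mass.
  have hν0 : ∀ a b, ν (Icc a b) = ν (Ioc a b) := by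
    intro a b
    refine measure_congr ?_
    exact hν.ae_eq (Ioc_ae_eq_Icc (μ := volume)).symm
  have hU : ν (⋃ j, Ioc (x j) (y j)) < ENNReal.ofReal ε := by
    refine hνδ _ ?_ (MeasurableSet.iUnion fun j => measurableSet_Ioc)
    refine lt_of_lt_of_le ?_ hδ'
    rw [measure_iUnion hdisj (fun j => measurableSet_Ioc), tsum_fintype]
    simp_rw [Real.volume_Ioc]
    rw [← ENNReal.ofReal_sum_of_nonneg (fun j _ => sub_nonneg.2 (hxy j))]
    exact (ENNReal.ofReal_lt_ofReal_iff hδ'0).2 hsum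
  calc ∑ j, |f (y j) - f (x j)| ≤ ∑ j, ν.real (Ioc (x j) (y j)) := by
        refine Finset.sum_le_sum fun j _ => ?_
        have := h _ _ (hxy j)
        rwa [Measure.real, hν0] at this
    _ = ν.real (⋃ j, Ioc (x j) (y j)) := by
        rw [measureReal_iUnion_fintype hdisj (fun j => measurableSet_Ioc)]
    _ < ε := by
        rw [Measure.real, ← ENNReal.toReal_ofReal hε.le]
        exact (ENNReal.toReal_lt_toReal (measure_ne_top _ _) ENNReal.ofReal_ne_top).2 hU

/-- Gives access to the fundamental theorem of calculus. The pairs there are unordered, hence `min`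
and `max`. -/
theorem IsAbsolutelyContinuous.absolutelyContinuousOnInterval {f : ℝ → ℝ}
    (hf : IsAbsolutelyContinuous f) (a b : ℝ) : AbsolutelyContinuousOnInterval f a b := by
  rw [absolutelyContinuousOnInterval_iff]
  intro ε hε
  obtain ⟨δ, hδ, H⟩ := hf ε hε
  refine ⟨δ, hδ, fun I hI hsum => ?_⟩
  have := H I.1 (fun j => min (I.2 j).1 (I.2 j).2) (fun j => max (I.2 j).1 (I.2 j).2)
    (fun j => min_le_max) (fun i j hij => hI.2 (by simp) (by simp)
      (fun h => hij (Fin.ext h))) ?_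
  · rw [Finset.sum_range]
    convert this using 2 with j
    rcases le_total (I.2 j).1 (I.2 j).2 with h | h
    · rw [min_eq_left h, max_eq_right h, dist_comm, Real.dist_eq]
    · rw [min_eq_right h, max_eq_left h, Real.dist_eq]
  · rw [Finset.sum_range] at hsum
    convert hsum using 2 with j
    rw [max_sub_min_eq_abs', Real.dist_eq]

theorem IsAbsolutelyContinuous.continuous {f : ℝ → ℝ} (hf : IsAbsolutelyContinuous f) :
    Continuous f :=
  continuous_iff_continuousAt.2 fun x =>
    (hf.absolutelyContinuousOnInterval (x - 1) (x + 1)).continuousOn.continuousAt (by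
      rw [uIcc_of_le (by linarith)]
      exact Icc_mem_nhds (by linarith) (by linarith))

/-! ### Parallel sections and the frontier -/

theorem norm_perp (θ : Plane) : ‖perp θ‖ = ‖θ‖ := by
  rw [← sq_eq_sq₀ (norm_nonneg _) (norm_nonneg _), EuclideanSpace.norm_sq_eq,
    EuclideanSpace.norm_sq_eq]
  simp [perp, add_comm]

theorem inner_combination_left {θ : Plane} (hθ : ‖θ‖ = 1) (r s : ℝ) :
    inner ℝ (r • θ + s • perp θ) θ = r :=
  (inner_eq_iff_exists_perp θ hθ r _).2 ⟨s, rfl⟩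

theorem inner_combination_right {θ : Plane} (hθ : ‖θ‖ = 1) (r s : ℝ) :
    inner ℝ (r • θ + s • perp θ) (perp θ) = s := by
  have h := (norm_eq_one_iff_coords θ).1 hθ
  rw [inner_eq_coords]
  simp [perp]
  linear_combination s * h

/-- A connected set meeting both `A` and its complement meets the frontier of `A`. -/
theorem IsPreconnected.inter_frontier_nonempty_of_mem_of_notMem {X : Type*} [TopologicalSpace X]
    {s A : Set X} (hs : IsPreconnected s) {x y : X} (hx : x ∈ s) (hxA : x ∈ A) (hy : y ∈ s)
    (hyA : y ∉ A) : (s ∩ frontier A).Nonempty := by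
  by_contra hne
  rw [not_nonempty_iff_eq_empty, ← disjoint_iff_inter_eq_empty] at hne
  have hx' : x ∈ interior A := by
    by_contra h
    exact disjoint_left.1 hne hx ⟨subset_closure hxA, h⟩
  have hcov : s ⊆ interior A ∪ (closure A)ᶜ := by
    intro z hz
    by_contra h
    simp only [mem_union, mem_compl_iff, not_or, not_not] at h
    exact disjoint_left.1 hne hz ⟨h.2, h.1⟩
  have hsub := hs.subset_left_of_subset_union isOpen_interior isClosed_closure.isOpen_compl
    (disjoint_left.2 fun z hz h => h (subset_closure (interior_subset hz))) hcov ⟨x, hx, hx'⟩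
  exact hyA (interior_subset (hsub hy))

/-- Two parallel sections of a set differ at most over the projection of the part of the frontier
between them. -/
theorem section_subset_union_projection {E : Set Plane} {θ : Plane} (hθ : ‖θ‖ = 1) {a b c d : ℝ}
    (hc : c ∈ Icc a b) (hd : d ∈ Icc a b) :
    {s : ℝ | c • θ + s • perp θ ∈ E} ⊆ {s : ℝ | d • θ + s • perp θ ∈ E} ∪
      (fun x => inner ℝ x (perp θ)) '' (frontier E ∩ {x | inner ℝ x θ ∈ Icc a b}) := by
  intro s hs
  by_cases hsd : d • θ + s • perp θ ∈ E
  · exact Or.inl hsd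
  right
  have hcont : Continuous (fun r : ℝ => r • θ + s • perp θ) := by fun_prop
  obtain ⟨_, ⟨r, hr, rfl⟩, hrE⟩ :=
    (isPreconnected_Icc.image _ hcont.continuousOn).inter_frontier_nonempty_of_mem_of_notMem
      (mem_image_of_mem _ hc) hs (mem_image_of_mem _ hd) hsd
  refine ⟨r • θ + s • perp θ, ⟨hrE, ?_⟩, inner_combination_right hθ r s⟩
  change inner ℝ (r • θ + s • perp θ) θ ∈ Icc a b
  rwa [inner_combination_left hθ]

/-- Orthogonal projection is 1-Lipschitz, so it does not increase length. -/
theorem volume_projection_le {θ : Plane} (hθ : ‖θ‖ = 1) (A : Set Plane) :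
    volume ((fun x : Plane => (inner ℝ x θ : ℝ)) '' A) ≤ Measure.hausdorffMeasure 1 A := by
  have hL : LipschitzWith 1 (fun x : Plane => (inner ℝ x θ : ℝ)) := by
    refine LipschitzWith.of_dist_le_mul fun x y => ?_
    rw [Real.dist_eq, ← inner_sub_left, dist_eq_norm]
    simpa [hθ] using abs_real_inner_le_norm (x - y) θ
  simpa [hausdorffMeasure_real] using hL.hausdorffMeasure_image_le (d := 1) zero_le_one A

theorem section_subset_Icc {E : Set Plane} {R : ℝ} (hR : ∀ x ∈ E, ‖x‖ ≤ R) {θ : Plane}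
    (hθ : ‖θ‖ = 1) (r : ℝ) : {s : ℝ | r • θ + s • perp θ ∈ E} ⊆ Icc (-R) R := by
  intro s hs
  have h := abs_real_inner_le_norm (r • θ + s • perp θ) (perp θ)
  rw [inner_combination_right hθ, norm_perp, hθ, mul_one] at h
  exact abs_le.1 (h.trans (hR _ hs))

theorem radonTransform_eq_zero_of_lt {E : Set Plane} {R : ℝ} (hR : ∀ x ∈ E, ‖x‖ ≤ R) {θ : Plane}
    (hθ : ‖θ‖ = 1) {r : ℝ} (hr : R < |r|) : radonTransform E θ r = 0 := by
  have : {s : ℝ | r • θ + s • perp θ ∈ E} = ∅ := by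
    refine eq_empty_of_forall_notMem fun s hs => ?_
    have h := abs_real_inner_le_norm (r • θ + s • perp θ) θ
    rw [inner_combination_left hθ, hθ, mul_one] at h
    exact absurd (h.trans (hR _ hs)) (not_le.2 hr)
  simp [radonTransform, this]

theorem volume_section_ne_top {E : Set Plane} (hE : Bornology.IsBounded E) {θ : Plane}
    (hθ : ‖θ‖ = 1) (r : ℝ) : volume {s : ℝ | r • θ + s • perp θ ∈ E} ≠ ⊤ := by
  obtain ⟨R, hR⟩ := hE.exists_norm_le
  exact measure_ne_top_of_subset (section_subset_Icc hR hθ r) (by simp)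

/-- The Radon transform of a bounded set with rectifiable frontier of finite length is absolutely
continuous for all but countably many directions. -/
theorem countable_not_isAbsolutelyContinuous_radonTransform {E : Set Plane}
    (hE : Bornology.IsBounded E) (hrect : IsRectifiable (frontier E))
    (hfin : Measure.hausdorffMeasure 1 (frontier E) < ⊤) :
    Set.Countable {θ : Plane | ‖θ‖ = 1 ∧ ¬ IsAbsolutelyContinuous (radonTransform E θ)} := by
  refine hrect.countable_exceptional_directions.mono ?_
  rintro θ ⟨hθ, hac⟩
  refine ⟨hθ, fun hN => hac ?_⟩
  let p : Plane → ℝ := fun x => inner ℝ x θ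
  have hp : Measurable p := by fun_prop
  -- The image of `σ` under `p` is the measure that dominates the increments.
  let σ : Measure Plane := (Measure.hausdorffMeasure 1).restrict (frontier E)
  have : IsFiniteMeasure σ := ⟨by simpa [σ] using hfin⟩
  have hν : σ.map p ≪ volume := by
    refine Measure.AbsolutelyContinuous.mk fun N hNm hN0 => ?_
    rw [Measure.map_apply hp hNm, Measure.restrict_apply (hp hNm), inter_comm]
    exact hN N hN0
  refine isAbsolutelyContinuous_of_measure hν fun a b hab => ?_
  have key : ∀ c ∈ Icc a b, ∀ d ∈ Icc a b,
      radonTransform E θ c ≤ radonTransform E θ d + (σ.map p).real (Icc a b) := by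
    intro c hc d hd
    have h1 : volume {s : ℝ | c • θ + s • perp θ ∈ E} ≤
        volume {s : ℝ | d • θ + s • perp θ ∈ E} + (σ.map p) (Icc a b) := by
      refine (measure_mono (section_subset_union_projection hθ hc hd)).trans
        ((measure_union_le _ _).trans ?_)
      refine add_le_add le_rfl ?_
      rw [Measure.map_apply hp measurableSet_Icc,
        Measure.restrict_apply (hp measurableSet_Icc), inter_comm]
      exact volume_projection_le ((norm_perp θ).trans hθ) _
    have h2 := volume_section_ne_top hE hθ d
    rw [radonTransform, radonTransform, Measure.real, ← ENNReal.toReal_add h2 (measure_ne_top _ _)]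
    exact ENNReal.toReal_mono (ENNReal.add_ne_top.2 ⟨h2, measure_ne_top _ _⟩) h1
  have h1 := key a (left_mem_Icc.2 hab) b (right_mem_Icc.2 hab)
  have h2 := key b (right_mem_Icc.2 hab) a (left_mem_Icc.2 hab)
  rw [abs_le]
  constructor <;> linarith

/-! ### Rapidly oscillating sets -/

/-- The sawtooth set indicator `r ↦ 1_{fract r < w} - w`, a function of period one and of mean
zero. -/
noncomputable def centeredIndicator (w r : ℝ) : ℝ := (if Int.fract r < w then 1 else 0) - w

theorem measurable_centeredIndicator (w : ℝ) : Measurable (centeredIndicator w) :=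
  (Measurable.ite (measurableSet_lt measurable_fract measurable_const)
    measurable_const measurable_const).sub_const w

theorem abs_centeredIndicator_le {w : ℝ} (hw : w ∈ Icc (0 : ℝ) 1) (r : ℝ) :
    |centeredIndicator w r| ≤ 1 := by
  unfold centeredIndicator
  rw [abs_le]
  split_ifs <;> constructor <;> linarith [hw.1, hw.2]

theorem intervalIntegrable_centeredIndicator {w : ℝ} (hw : w ∈ Icc (0 : ℝ) 1) (N a b : ℝ) :
    IntervalIntegrable (fun r => centeredIndicator w (N * r)) volume a b := by
  refine (intervalIntegrable_const (c := (1 : ℝ))).mono_fun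
    ((measurable_centeredIndicator w).comp (by fun_prop)).aestronglyMeasurable ?_
  exact Filter.Eventually.of_forall fun r => by
    simpa using abs_centeredIndicator_le hw (N * r)

theorem integral_centeredIndicator {w : ℝ} (hw : w ∈ Icc (0 : ℝ) 1) (k : ℤ) :
    ∫ r in (k : ℝ)..(k + 1), centeredIndicator w r = 0 := by
  have hper : Function.Periodic (centeredIndicator w) 1 := fun r => by
    simp [centeredIndicator]
  rw [hper.intervalIntegral_add_eq (k : ℝ) 0, zero_add]
  have hint : ∀ a b, IntervalIntegrable (centeredIndicator w) volume a b := fun a b => by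
    simpa using intervalIntegrable_centeredIndicator hw 1 a b
  rw [← intervalIntegral.integral_add_adjacent_intervals (hint 0 w) (hint w 1)]
  have h1 : ∫ r in (0 : ℝ)..w, centeredIndicator w r = ∫ r in (0 : ℝ)..w, (1 - w) := by
    rw [intervalIntegral.integral_of_le hw.1, intervalIntegral.integral_of_le hw.1,
      integral_Ioc_eq_integral_Ioo, integral_Ioc_eq_integral_Ioo]
    refine setIntegral_congr_fun measurableSet_Ioo fun r hr => ?_
    have : Int.fract r = r := Int.fract_eq_self.2 ⟨hr.1.le, hr.2.trans_le hw.2⟩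
    simp [centeredIndicator, this, hr.2]
  have h2 : ∫ r in w..1, centeredIndicator w r = ∫ r in w..1, (-w) := by
    rw [intervalIntegral.integral_of_le hw.2, intervalIntegral.integral_of_le hw.2,
      integral_Ioc_eq_integral_Ioo, integral_Ioc_eq_integral_Ioo]
    refine setIntegral_congr_fun measurableSet_Ioo fun r hr => ?_
    have : Int.fract r = r := Int.fract_eq_self.2 ⟨hw.1.trans hr.1.le, hr.2⟩
    simp [centeredIndicator, this, hr.1.le]
  rw [h1, h2]
  simp
  ring

/-- A Riemann–Lebesgue lemma, uniform over all translates, for the rapidly oscillating mean zero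
functions `centeredIndicator`. -/
theorem exists_integral_centeredIndicator_mul_le {w : ℝ} (hw : w ∈ Icc (0 : ℝ) 1) {g : ℝ → ℝ}
    (hg : Integrable g) {e : ℝ} (he : 0 < e) :
    ∃ N : ℕ, ∀ (m : ℤ) (s : ℝ),
      |∫ r in (m : ℝ)..(m + 1), centeredIndicator w (N * r) * g (r - s)| ≤ e := by
  -- The `L¹` error and the modulus of continuity of `h` are unchanged by translation, so `N` serves
  -- all `m` and `s`.
  obtain ⟨h, hcs, hgh, hcont, hhi⟩ := hg.exists_hasCompactSupport_integral_sub_le (half_pos he)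
  obtain ⟨δ, hδ, hunif⟩ := Metric.uniformContinuous_iff.1
    (hcs.uniformContinuous_of_continuous hcont) (e / 2) (half_pos he)
  obtain ⟨N, hN⟩ := exists_nat_gt (1 / δ)
  have hN0 : (0 : ℝ) < N := (by positivity : 0 < 1 / δ).trans hN
  have hNδ : 1 / (N : ℝ) < δ := by
    rw [div_lt_comm₀ hδ hN0] at hN
    exact hN
  refine ⟨N, fun m s => ?_⟩
  set φ : ℝ → ℝ := fun r => centeredIndicator w (N * r) with hφ
  have hφi : ∀ a b, IntervalIntegrable φ volume a b := intervalIntegrable_centeredIndicator hw N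
  have hφ1 : ∀ r, |φ r| ≤ 1 := fun r => abs_centeredIndicator_le hw _
  have hφm : Measurable φ := (measurable_centeredIndicator w).comp (by fun_prop)
  have hmul : ∀ u : ℝ → ℝ, Integrable u → ∀ a b,
      IntervalIntegrable (fun r => φ r * u (r - s)) volume a b := fun u hu a b =>
    ((hu.comp_sub_right s).bdd_mul hφm.aestronglyMeasurable
      (Filter.Eventually.of_forall hφ1)).intervalIntegrable
  have hcell : ∀ k : ℕ, |∫ r in (m + k / N : ℝ)..(m + (k + 1 : ℕ) / N), φ r * h (r - s)| ≤
      e / 2 * (1 / N) := by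
    intro k
    set p : ℝ := m + k / N with hp
    have hq : (m : ℝ) + (k + 1 : ℕ) / N = p + 1 / N := by rw [hp]; push_cast; ring
    rw [hq]
    have hmean : ∫ r in p..(p + 1 / N), φ r = 0 := by
      rw [hφ, intervalIntegral.integral_comp_mul_left _ hN0.ne']
      have e1 : (N : ℝ) * p = ((N * m + k : ℤ) : ℝ) := by
        rw [hp]; push_cast; field_simp
      have e2 : (N : ℝ) * (p + 1 / N) = ((N * m + k : ℤ) : ℝ) + 1 := by
        rw [mul_add, e1]; field_simp
      rw [e1, e2, integral_centeredIndicator hw, smul_zero]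
    -- Over a full period the mean is zero, so a constant may be subtracted from `h`, leaving only
    -- its oscillation.
    have hsplit : ∫ r in p..(p + 1 / N), φ r * h (r - s) =
        ∫ r in p..(p + 1 / N), φ r * (h (r - s) - h (p - s)) := by
      simp_rw [mul_sub]
      rw [intervalIntegral.integral_sub (hmul h hhi _ _) ((hφi _ _).mul_const _),
        intervalIntegral.integral_mul_const, hmean, zero_mul, sub_zero]
    rw [hsplit]
    have := intervalIntegral.norm_integral_le_of_norm_le_const (a := p) (b := p + 1 / N)
      (f := fun r => φ r * (h (r - s) - h (p - s))) (C := e / 2) (fun r hr => ?_)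
    · rwa [add_sub_cancel_left, abs_of_pos (by positivity), Real.norm_eq_abs] at this
    · rw [uIoc_of_le (by simp)] at hr
      have hd : dist (r - s) (p - s) < δ := by
        rw [Real.dist_eq, abs_of_nonneg] <;> linarith [hr.1, hr.2]
      have := (hunif hd).le
      rw [Real.dist_eq] at this
      rw [norm_mul, Real.norm_eq_abs, Real.norm_eq_abs]
      calc |φ r| * |h (r - s) - h (p - s)| ≤ 1 * (e / 2) := by
            gcongr
            exact hφ1 r
        _ = e / 2 := one_mul _
  have hcont_part : |∫ r in (m : ℝ)..(m + 1), φ r * h (r - s)| ≤ e / 2 := by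
    have := intervalIntegral.sum_integral_adjacent_intervals (n := N) (μ := volume)
      (f := fun r => φ r * h (r - s)) (a := fun k : ℕ => (m + k / N : ℝ))
      (fun k _ => hmul h hhi _ _)
    simp only [Nat.cast_zero, zero_div, add_zero, div_self hN0.ne'] at this
    rw [← this]
    refine (Finset.abs_sum_le_sum_abs _ _).trans ((Finset.sum_le_sum fun k _ => hcell k).trans ?_)
    rw [Finset.sum_const, Finset.card_range, nsmul_eq_mul]
    apply le_of_eq
    field_simp
  have hrest : |∫ r in (m : ℝ)..(m + 1), φ r * (g (r - s) - h (r - s))| ≤ e / 2 := by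
    refine le_trans ?_ hgh
    rw [intervalIntegral.integral_of_le (by linarith)]
    refine (abs_integral_le_integral_abs).trans ?_
    calc ∫ r in Ioc (m : ℝ) (m + 1), |φ r * (g (r - s) - h (r - s))|
        ≤ ∫ r in Ioc (m : ℝ) (m + 1), ‖g (r - s) - h (r - s)‖ := by
          refine integral_mono_of_nonneg (Filter.Eventually.of_forall fun r => abs_nonneg _)
            (((hg.sub hhi).comp_sub_right s).norm.integrableOn)
            (Filter.Eventually.of_forall fun r => ?_)
          simp only
          rw [abs_mul, Real.norm_eq_abs]
          exact mul_le_of_le_one_left (abs_nonneg _) (hφ1 r)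
      _ ≤ ∫ r, ‖g (r - s) - h (r - s)‖ :=
          setIntegral_le_integral ((hg.sub hhi).comp_sub_right s).norm
            (Filter.Eventually.of_forall fun r => norm_nonneg _)
      _ = ∫ r, ‖g r - h r‖ := integral_sub_right_eq_self (fun r => ‖g r - h r‖) s
  have hsum : ∫ r in (m : ℝ)..(m + 1), φ r * g (r - s) =
      (∫ r in (m : ℝ)..(m + 1), φ r * h (r - s)) +
        ∫ r in (m : ℝ)..(m + 1), φ r * (g (r - s) - h (r - s)) := by
    rw [← intervalIntegral.integral_add (hmul h hhi _ _)
      (hmul (fun x => g x - h x) (hg.sub hhi) _ _)]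
    congr 1
    ext r
    ring
  rw [hsum]
  linarith [abs_add_le (∫ r in (m : ℝ)..(m + 1), φ r * h (r - s))
    (∫ r in (m : ℝ)..(m + 1), φ r * (g (r - s) - h (r - s)))]

/-! ### A test set on the line -/

/-- Summation by parts. The fictitious weight `v` before `w 0` is arbitrary, as it only multiplies
`F 0 = 0`. -/
theorem sum_mul_sub_eq_neg_sum {w F : ℕ → ℝ} {v : ℝ} {n : ℕ} (h0 : F 0 = 0) (hn : F n = 0) :
    ∑ k ∈ Finset.range n, w k * (F (k + 1) - F k) =
      -∑ k ∈ Finset.range n, (w k - if k = 0 then v else w (k - 1)) * F k := by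
  have key : ∀ n, ∑ k ∈ Finset.range n, w k * (F (k + 1) - F k) =
      (if n = 0 then v else w (n - 1)) * F n - v * F 0 -
        ∑ k ∈ Finset.range n, (w k - if k = 0 then v else w (k - 1)) * F k := by
    intro n
    induction n with
    | zero => simp
    | succ n ih =>
      rw [Finset.sum_range_succ, Finset.sum_range_succ, ih]
      simp only [Nat.add_eq_zero_iff, one_ne_zero, and_false, if_false, Nat.add_sub_cancel]
      ring
  rw [key n, h0, hn]
  ring

/-- A positive function on the integers has a positive minorant of its minima over windows. -/
theorem exists_pos_mul_le_of_window {d : ℤ → ℝ} (hd : ∀ m, 0 < d m) {C : ℝ} (hC : 0 < C) (n : ℕ)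
    (k : ℤ) : ∃ e : ℝ, 0 < e ∧ ∀ m : ℤ, |k - m| ≤ n → e * C ≤ d m := by
  obtain ⟨m₀, -, hm₀⟩ := (Finset.Icc (k - n) (k + n)).exists_min_image d
    ⟨k, by rw [Finset.mem_Icc]; omega⟩
  refine ⟨d m₀ / C, div_pos (hd _) hC, fun m hm => ?_⟩
  rw [div_mul_cancel₀ _ hC.ne']
  refine hm₀ m ?_
  rw [abs_le] at hm
  rw [Finset.mem_Icc]
  omega

/-- For an absolutely continuous `f ≥ 0` with bounded support which is bounded below on an interval
of length one there is a measurable set whose translates integrate the derivative of `f` to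
negative values. -/
theorem exists_setIntegral_deriv_neg {f g : ℝ → ℝ} {R c a : ℝ} (hg : Integrable g)
    (hfg : ∀ x y, ∫ t in x..y, g t = f y - f x) (hf0 : ∀ x, R < |x| → f x = 0)
    (hg0 : ∀ x, R < |x| → g x = 0) (hnn : ∀ x, 0 ≤ f x) (hc : 0 < c)
    (hfc : ∀ x ∈ Icc a (a + 1), c ≤ f x) :
    ∃ S : Set ℝ, MeasurableSet S ∧ ∀ s, ∫ r in S, g (r - s) < 0 := by
  -- The `n = 2q + 1` unit cells starting at `⌊s⌋ - q` cover `[s - R, s + R]`.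
  obtain ⟨q, hq⟩ := exists_nat_gt R
  set n : ℕ := 2 * q + 1 with hn
  set w : ℤ → ℝ := fun m => Real.sigmoid m with hw
  have hw01 : ∀ m, w m ∈ Icc (0 : ℝ) 1 := fun m => ⟨Real.sigmoid_nonneg _, Real.sigmoid_le_one _⟩
  have hd : ∀ m : ℤ, 0 < c * (w m - w (m - 1)) := fun m =>
    mul_pos hc (sub_pos.2 (Real.sigmoid_strictMono (by simp)))
  -- Error budget: `n + 1` times `e k` is at most the gain `c * (w m - w (m - 1))` of every `m`
  -- within distance `n` of `k`.
  choose e he hed using fun k => exists_pos_mul_le_of_window hd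
    (by positivity : (0 : ℝ) < n + 1) n k
  choose N hN using fun m => exists_integral_centeredIndicator_mul_le (hw01 m) hg (he m)
  let S : Set ℝ := {r | Int.fract (N ⌊r⌋ * r) < w ⌊r⌋}
  have hS : MeasurableSet S := by
    have h1 : Measurable (fun r : ℝ => (N ⌊r⌋ : ℝ)) :=
      (measurable_from_top (f := fun k : ℤ => (N k : ℝ))).comp Int.measurable_floor
    have h2 : Measurable (fun r : ℝ => w ⌊r⌋) :=
      (measurable_from_top (f := w)).comp Int.measurable_floor
    exact measurableSet_lt (measurable_fract.comp (h1.mul measurable_id)) h2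
  refine ⟨S, hS, fun s => ?_⟩
  have hgs : Integrable (fun r => g (r - s)) := hg.comp_sub_right s
  have hgS : Integrable (S.indicator fun r => g (r - s)) := hgs.indicator hS
  have hcell : ∀ m : ℤ, ∫ r in (m : ℝ)..(m + 1), S.indicator (fun r => g (r - s)) r ≤
      e m + w m * (f (m + 1 - s) - f (m - s)) := by
    intro m
    have h1 : ∫ r in (m : ℝ)..(m + 1), S.indicator (fun r => g (r - s)) r =
        ∫ r in (m : ℝ)..(m + 1),
          (centeredIndicator (w m) (N m * r) * g (r - s) + w m * g (r - s)) := by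
      rw [intervalIntegral.integral_of_le (by simp), intervalIntegral.integral_of_le (by simp),
        integral_Ioc_eq_integral_Ioo, integral_Ioc_eq_integral_Ioo]
      refine setIntegral_congr_fun measurableSet_Ioo fun r hr => ?_
      have hfl : ⌊r⌋ = m := Int.floor_eq_iff.2 ⟨hr.1.le, hr.2⟩
      by_cases hrS : Int.fract (N m * r) < w m
      · have : r ∈ S := by simpa [S, hfl] using hrS
        simp only [indicator_of_mem this, centeredIndicator, hrS, if_true]
        ring
      · have : r ∉ S := by simpa [S, hfl] using hrS
        simp [indicator_of_notMem this, centeredIndicator, hrS]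
    have hφ : IntervalIntegrable (fun r => centeredIndicator (w m) (N m * r) * g (r - s))
        volume (m : ℝ) (m + 1) :=
      (hgs.bdd_mul ((measurable_centeredIndicator _).comp (by fun_prop)).aestronglyMeasurable
        (Filter.Eventually.of_forall fun r =>
          abs_centeredIndicator_le (hw01 m) _)).intervalIntegrable
    rw [h1, intervalIntegral.integral_add hφ (hgs.intervalIntegrable.const_mul _),
      intervalIntegral.integral_const_mul, intervalIntegral.integral_comp_sub_right, hfg]
    linarith [(abs_le.1 (hN m m s)).2]
  set A : ℤ := ⌊s⌋ - q with hA
  have hs1 := Int.floor_le s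
  have hs2 := Int.lt_floor_add_one s
  have hAs : (A : ℝ) = ⌊s⌋ - q := by simp [hA]
  have hleft : R < |(A : ℝ) - s| := lt_abs.2 (Or.inr (by rw [hAs]; linarith))
  have hright : R < |(A + n : ℝ) - s| := lt_abs.2 (Or.inl (by rw [hAs, hn]; push_cast; linarith))
  have hsub : Function.support (S.indicator fun r => g (r - s)) ⊆ Ioc (A : ℝ) (A + n) := by
    intro r hr
    have h1 : g (r - s) ≠ 0 := fun h => hr (by by_cases h' : r ∈ S <;> simp [h', h])
    have h2 : |r - s| ≤ R := not_lt.1 fun h => h1 (hg0 _ h)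
    rw [abs_le] at h2
    rw [hAs, hn]
    push_cast
    constructor <;> linarith
  have hG : ∫ r in S, g (r - s) = ∑ k ∈ Finset.range n,
      ∫ r in ((A + k : ℤ) : ℝ)..((A + k : ℤ) + 1), S.indicator (fun r => g (r - s)) r := by
    rw [← integral_indicator hS, ← intervalIntegral.integral_eq_integral_of_support_subset hsub]
    have := intervalIntegral.sum_integral_adjacent_intervals (n := n) (μ := volume)
      (f := S.indicator (fun r => g (r - s))) (a := fun k : ℕ => ((A : ℝ) + k))
      (fun k _ => hgS.intervalIntegrable)
    simp only [Nat.cast_zero, add_zero] at this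
    rw [← this]
    refine Finset.sum_congr rfl fun k _ => ?_
    push_cast
    rw [add_assoc]
  -- `m₀ - s` lies in `[a, a + 1]`, so the jump of `w` at `m₀` contributes its full gain.
  set m₀ : ℤ := ⌈s + a⌉ with hm₀
  have hm1 := Int.le_ceil (s + a)
  have hm2 := Int.ceil_lt_add_one (s + a)
  have hfm : c ≤ f (m₀ - s) := hfc _ ⟨by linarith, by linarith⟩
  have hmR : |(m₀ : ℝ) - s| ≤ R := not_lt.1 fun h => by
    rw [hf0 _ h] at hfm
    exact absurd hc (not_lt.2 hfm)
  rw [abs_le] at hmR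
  have hAm : A ≤ m₀ := by
    have : (A : ℝ) ≤ m₀ := by rw [hAs]; linarith
    exact_mod_cast this
  have hmA : m₀ < A + n := by
    have : (m₀ : ℝ) < A + n := by rw [hAs, hn]; push_cast; linarith
    exact_mod_cast this
  obtain ⟨k₀, hk₀⟩ := Int.eq_ofNat_of_zero_le (sub_nonneg.2 hAm)
  have hk₀' : m₀ = A + k₀ := by omega
  have hk₀n : k₀ ∈ Finset.range n := by rw [Finset.mem_range]; omega
  have hparts := sum_mul_sub_eq_neg_sum (w := fun k : ℕ => w (A + k))
    (F := fun k : ℕ => f ((A + k : ℝ) - s)) (v := w (A - 1)) (n := n)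
    (by simpa using hf0 _ hleft) (hf0 _ hright)
  have hjump : ∀ k : ℕ, (w (A + k) - if k = 0 then w (A - 1) else w (A + (k - 1 : ℕ))) =
      w (A + k) - w (A + k - 1) := by
    intro k
    rcases k with _ | k
    · simp
    · simp [add_sub_assoc]
  simp only [hjump] at hparts
  have hmain : c * (w m₀ - w (m₀ - 1)) ≤
      ∑ k ∈ Finset.range n, (w (A + k) - w (A + k - 1)) * f ((A + k : ℝ) - s) := by
    have h1 := Finset.single_le_sum (f := fun k : ℕ =>
      (w (A + k) - w (A + k - 1)) * f ((A + k : ℝ) - s)) (fun k _ =>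
        mul_nonneg (pos_of_mul_pos_right (hd (A + k)) hc.le).le (hnn _)) hk₀n
    refine le_trans ?_ h1
    have h2 : ((A : ℝ) + k₀) = m₀ := by rw [hk₀']; push_cast; rfl
    rw [h2, ← hk₀', mul_comm]
    exact mul_le_mul_of_nonneg_left hfm (pos_of_mul_pos_right (hd m₀) hc.le).le
  have herr : ∑ k ∈ Finset.range n, e (A + k) < c * (w m₀ - w (m₀ - 1)) := by
    have h1 : ∀ k ∈ Finset.range n, e (A + k) ≤ c * (w m₀ - w (m₀ - 1)) / (n + 1) := by
      intro k hk
      rw [Finset.mem_range] at hk hk₀n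
      rw [le_div_iff₀ (by positivity)]
      refine hed _ _ ?_
      rw [abs_le]
      omega
    refine (Finset.sum_le_sum h1).trans_lt ?_
    rw [Finset.sum_const, Finset.card_range, nsmul_eq_mul, ← mul_div_assoc,
      div_lt_iff₀ (by positivity)]
    nlinarith [hd m₀]
  rw [hG]
  calc _ ≤ ∑ k ∈ Finset.range n,
        (e (A + k) + w (A + k) * (f ((A + (k + 1 : ℕ) : ℝ) - s) - f ((A + k : ℝ) - s))) := by
        refine Finset.sum_le_sum fun k _ => (hcell _).trans (le_of_eq ?_)
        push_cast
        rw [add_assoc (A : ℝ)]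
    _ < 0 := by
        rw [Finset.sum_add_distrib, hparts]
        linarith

/-- Fubini replaces differentiation under the integral: the values at `s` and `t` differ by the
integral over `u` from `s` to `t` of the negative quantity `∫ r in S, g (r - u)`. -/
theorem exists_strictMono_setIntegral_of_le_on_unit_interval {f g : ℝ → ℝ} {R c a : ℝ}
    (hf : Continuous f) (hg : Integrable g)
    (hfg : ∀ x y, ∫ t in x..y, g t = f y - f x) (hf0 : ∀ x, R < |x| → f x = 0)
    (hg0 : ∀ x, R < |x| → g x = 0) (hnn : ∀ x, 0 ≤ f x) (hc : 0 < c)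
    (hfc : ∀ x ∈ Icc a (a + 1), c ≤ f x) :
    ∃ S : Set ℝ, MeasurableSet S ∧ StrictMono fun s => ∫ r in S, f (r - s) := by
  obtain ⟨S, hS, hneg⟩ := exists_setIntegral_deriv_neg hg hfg hf0 hg0 hnn hc hfc
  refine ⟨S, hS, fun s t hst => ?_⟩
  have hfi : Integrable f := hf.integrable_of_hasCompactSupport
    (HasCompactSupport.of_support_subset_isCompact (isCompact_Icc (a := -R) (b := R))
      fun x hx => abs_le.1 (not_lt.1 fun h => hx (hf0 x h)))
  have hprod : Integrable (fun p : ℝ × ℝ => g (p.2 - p.1))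
      ((volume.restrict (uIoc s t)).prod (volume.restrict S)) := by
    have h1 : Integrable (fun _ : ℝ => (1 : ℝ)) (volume.restrict (uIoc s t)) :=
      (intervalIntegrable_const (a := s) (b := t)).def'
    -- Joint integrability of `g (r - u)`, as the integrand of a convolution with `1` on a bounded
    -- interval.
    have h2 := h1.convolution_integrand (ContinuousLinearMap.mul ℝ ℝ) hg (μ := volume)
    have h3 := h2.swap
    simp only [Function.comp_def, ContinuousLinearMap.mul_apply', Prod.snd_swap, Prod.fst_swap,
      one_mul] at h3
    exact h3.mono_measure (Measure.prod_mono le_rfl Measure.restrict_le_self)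
  have hswap := intervalIntegral_integral_swap (f := fun u r => g (r - u)) hprod
  have hinner : ∀ r, ∫ u in s..t, g (r - u) = f (r - s) - f (r - t) := fun r => by
    rw [intervalIntegral.integral_comp_sub_left, hfg]
  simp_rw [hinner] at hswap
  rw [integral_sub (hfi.comp_sub_right s).integrableOn (hfi.comp_sub_right t).integrableOn] at hswap
  have hpos := intervalIntegral.intervalIntegral_pos_of_pos_on
    (f := fun u => -∫ r in S, g (r - u)) (a := s) (b := t) ?_ (fun u _ => neg_pos.2 (hneg u)) hst
  · rw [intervalIntegral.integral_neg] at hpos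
    linarith
  · rw [intervalIntegrable_iff]
    exact hprod.integral_prod_left.neg

/-- A nonnegative nonzero absolutely continuous function `f` with bounded support on the line is
determined among its translates by its integral over a suitable measurable set. -/
theorem IsAbsolutelyContinuous.exists_injective_setIntegral {f : ℝ → ℝ} {R : ℝ}
    (hf : IsAbsolutelyContinuous f) (hf0 : ∀ x, R < |x| → f x = 0) (hnn : ∀ x, 0 ≤ f x)
    (hne : ∃ x, f x ≠ 0) :
    ∃ S : Set ℝ, MeasurableSet S ∧ Function.Injective fun s => ∫ r in S, f (r - s) := by
  have hac := hf.absolutelyContinuousOnInterval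
  have hcont := hf.continuous
  have hg0 : ∀ x, R < |x| → deriv f x = 0 := by
    intro x hx
    have : f =ᶠ[nhds x] fun _ => 0 :=
      ((isOpen_lt continuous_const continuous_abs).eventually_mem hx).mono fun y hy => hf0 y hy
    rw [this.deriv_eq, deriv_const]
  have hfg : ∀ x y, ∫ t in x..y, deriv f t = f y - f x := fun x y => (hac x y).integral_deriv_eq_sub
  have hg : Integrable (deriv f) := by
    have h1 := ((hac (-(|R| + 1)) (|R| + 1)).intervalIntegrable_deriv)
    have hR := abs_nonneg R
    rw [intervalIntegrable_iff, uIoc_of_le (by linarith)] at h1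
    refine (integrableOn_iff_integrable_of_support_subset fun x hx => ?_).1 h1
    have := abs_le.1 (not_lt.1 fun h => hx (hg0 x h))
    have := le_abs_self R
    constructor <;> linarith
  obtain ⟨x₀, hx₀⟩ := hne
  have hx₀' : f x₀ / 2 < f x₀ := half_lt_self ((hnn x₀).lt_of_ne' hx₀)
  obtain ⟨η, hη, hball⟩ := Metric.eventually_nhds_iff.1
    (hcont.continuousAt.eventually (lt_mem_nhds hx₀'))
  -- Scaling by `l` turns `[x₀, x₀ + l]`, where `f > f x₀ / 2`, into a unit interval.
  set l : ℝ := η / 2 with hl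
  have hl0 : 0 < l := half_pos hη
  obtain ⟨S, hS, hmono⟩ := exists_strictMono_setIntegral_of_le_on_unit_interval
    (f := fun x => f (l * x)) (g := fun x => l * deriv f (l * x)) (R := R / l)
    (c := f x₀ / 2) (a := x₀ / l) (by fun_prop)
    ((hg.comp_mul_left' hl0.ne').const_mul l) (fun x y => by
      rw [intervalIntegral.integral_const_mul, intervalIntegral.integral_comp_mul_left _ hl0.ne',
        hfg, smul_eq_mul, mul_inv_cancel_left₀ hl0.ne'])
    (fun x hx => hf0 _ (by rwa [abs_mul, abs_of_pos hl0, ← div_lt_iff₀' hl0]))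
    (fun x hx => by
      rw [hg0 _ (by rwa [abs_mul, abs_of_pos hl0, ← div_lt_iff₀' hl0]), mul_zero])
    (fun x => hnn _) (half_pos ((hnn x₀).lt_of_ne' hx₀)) (fun x hx => by
      refine (hball ?_).le
      have h1 := hx.1
      have h2 := hx.2
      rw [div_le_iff₀' hl0] at h1
      rw [← sub_le_iff_le_add, le_div_iff₀' hl0] at h2
      rw [Real.dist_eq, abs_lt]
      constructor <;> linarith)
  refine ⟨(fun r => l⁻¹ * r) ⁻¹' S, hS.preimage (by fun_prop), fun s t hst => ?_⟩
  have hscale : ∀ s, ∫ r in (fun r => l⁻¹ * r) ⁻¹' S, f (r - s) =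
      l * ∫ r in S, f (l * (r - s / l)) := by
    intro s
    rw [← integral_indicator (hS.preimage (by fun_prop)), ← integral_indicator hS]
    have := Measure.integral_comp_mul_left
      (fun r => S.indicator (fun r => f (l * (r - s / l))) r) l⁻¹
    rw [inv_inv, abs_of_pos hl0, smul_eq_mul] at this
    rw [← this]
    congr 1
    ext r
    by_cases hr : l⁻¹ * r ∈ S
    · rw [indicator_of_mem hr, indicator_of_mem (s := (fun r => l⁻¹ * r) ⁻¹' S) hr]
      congr 1
      field_simp
    · rw [indicator_of_notMem hr, indicator_of_notMem (s := (fun r => l⁻¹ * r) ⁻¹' S) hr]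
  simp only [hscale] at hst
  have := hmono.injective (mul_left_cancel₀ hl0.ne' hst)
  exact (div_left_inj' hl0.ne').1 this

/-! ### Fubini in rotated coordinates and planar test sets -/

/-- Passing to a measurable hull changes almost every section by a null set only. This is needed
because `E` is merely null measurable. -/
theorem prod_apply_of_nullMeasurableSet {α β : Type*} [MeasurableSpace α] [MeasurableSpace β]
    {μ : Measure α} {ν : Measure β} [SFinite ν] {s : Set (α × β)}
    (hs : NullMeasurableSet s (μ.prod ν)) :
    μ.prod ν s = ∫⁻ x, ν (Prod.mk x ⁻¹' s) ∂μ := by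
  rw [← measure_toMeasurable, Measure.prod_apply (measurableSet_toMeasurable _ _)]
  refine lintegral_congr_ae ?_
  filter_upwards [Measure.ae_ae_of_ae_prod hs.toMeasurable_ae_eq] with x hx
  exact measure_congr hx

/-- The isometry of the plane which takes the standard frame to the frame `θ, perp θ`. -/
noncomputable def rotationIsometry (θ : Plane) (hθ : ‖θ‖ = 1) : Plane →ₗᵢ[ℝ] Plane where
  toFun x := x 0 • θ + x 1 • perp θ
  map_add' x y := by
    simp only [PiLp.add_apply]
    module
  map_smul' c x := by
    simp only [PiLp.smul_apply, smul_eq_mul, RingHom.id_apply]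
    module
  norm_map' x := by
    have h := (norm_eq_one_iff_coords θ).1 hθ
    rw [← sq_eq_sq₀ (norm_nonneg _) (norm_nonneg _), EuclideanSpace.norm_sq_eq,
      EuclideanSpace.norm_sq_eq]
    simp [perp]
    linear_combination (x 0 ^ 2 + x 1 ^ 2) * h

theorem measurePreserving_combination {θ : Plane} (hθ : ‖θ‖ = 1) :
    MeasurePreserving (fun p : ℝ × ℝ => p.1 • θ + p.2 • perp θ) := by
  have h1 := ((rotationIsometry θ hθ).toLinearIsometryEquiv rfl).measurePreserving
  have h2 := (PiLp.volume_preserving_toLp (Fin 2)).comp (volume_preserving_finTwoArrow ℝ).symm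
  exact h1.comp h2

/-- Fubini's theorem in the coordinates given by a unit vector `θ`. -/
theorem volume_inter_strip_eq_lintegral {E : Set Plane} (hE : NullMeasurableSet E volume)
    {θ : Plane} (hθ : ‖θ‖ = 1) {S : Set ℝ} (hS : MeasurableSet S) :
    volume (E ∩ {x | inner ℝ x θ ∈ S}) =
      ∫⁻ r in S, volume {s : ℝ | r • θ + s • perp θ ∈ E} := by
  have hmp := measurePreserving_combination hθ
  have hp : Measurable (fun x : Plane => (inner ℝ x θ : ℝ)) := by fun_prop
  have hB : NullMeasurableSet (E ∩ {x | inner ℝ x θ ∈ S}) volume :=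
    hE.inter (hp hS).nullMeasurableSet
  rw [← hmp.measure_preimage hB, Measure.volume_eq_prod,
    prod_apply_of_nullMeasurableSet (hB.preimage hmp.quasiMeasurePreserving),
    ← lintegral_indicator hS]
  congr 1
  ext r
  by_cases hr : r ∈ S
  · rw [indicator_of_mem hr]
    congr 1
    ext s
    change _ ∧ inner ℝ (r • θ + s • perp θ) θ ∈ S ↔ _
    rw [inner_combination_left hθ]
    exact and_iff_left hr
  · rw [indicator_of_notMem hr]
    convert measure_empty (μ := (volume : Measure ℝ))
    refine eq_empty_of_forall_notMem fun s hs => hr ?_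
    have : inner ℝ (r • θ + s • perp θ) θ ∈ S := hs.2
    rwa [inner_combination_left hθ] at this

theorem toReal_volume_inter_strip {E : Set Plane} (hb : Bornology.IsBounded E)
    (hE : NullMeasurableSet E volume) {θ : Plane} (hθ : ‖θ‖ = 1)
    (hm : Measurable (radonTransform E θ)) {S : Set ℝ} (hS : MeasurableSet S) :
    (volume (E ∩ {x | inner ℝ x θ ∈ S})).toReal = ∫ r in S, radonTransform E θ r := by
  rw [volume_inter_strip_eq_lintegral hE hθ hS, integral_eq_lintegral_of_nonneg_ae
    (f := radonTransform E θ) (Filter.Eventually.of_forall fun r => ENNReal.toReal_nonneg)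
    hm.aestronglyMeasurable]
  congr 2
  ext r
  rw [radonTransform, ENNReal.ofReal_toReal (volume_section_ne_top hb hθ r)]

/-- Translating `E` by `v` shifts its Radon transform by `⟨v, θ⟩`, so a strip sees `v` only through
this number. -/
theorem toReal_volume_translate_inter_strip {E : Set Plane} (hb : Bornology.IsBounded E)
    (hE : NullMeasurableSet E volume) {θ : Plane} (hθ : ‖θ‖ = 1)
    (hm : Measurable (radonTransform E θ)) {S : Set ℝ} (hS : MeasurableSet S) (v : Plane) :
    (volume (((fun x => x + v) '' E) ∩ {x | inner ℝ x θ ∈ S})).toReal =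
      ∫ r in S, radonTransform E θ (r - inner ℝ v θ) := by
  set τ : ℝ := inner ℝ v θ with hτ
  have hS' : MeasurableSet ((fun r => r + τ) ⁻¹' S) := hS.preimage (by fun_prop)
  have h1 : (fun x => x + v) ⁻¹' (((fun x => x + v) '' E) ∩ {x | inner ℝ x θ ∈ S}) =
      E ∩ {x | inner ℝ x θ ∈ (fun r => r + τ) ⁻¹' S} := by
    rw [preimage_inter, preimage_image_eq _ (add_left_injective v)]
    ext x
    simp [inner_add_left, hτ]
  rw [← measure_preimage_add_right volume v, h1, toReal_volume_inter_strip hb hE hθ hm hS',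
    ← integral_indicator hS', ← integral_indicator hS,
    ← integral_sub_right_eq_self (fun r => _) τ]
  congr 1
  ext r
  by_cases hr : r ∈ S <;> simp [indicator, hr]

/-- If the Radon transform of `E` in direction `θ` is absolutely continuous, then one test set
determines the component along `θ` of the translation vector of a translate of `E`. -/
theorem exists_test_set_of_isAbsolutelyContinuous {E : Set Plane} (hb : Bornology.IsBounded E)
    (hE : NullMeasurableSet E volume) (hpos : 0 < volume E) {θ : Plane} (hθ : ‖θ‖ = 1)
    (hac : IsAbsolutelyContinuous (radonTransform E θ)) :
    ∃ T : Set Plane, MeasurableSet T ∧ ∀ v w : Plane,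
      volume (((fun x => x + v) '' E) ∩ T) = volume (((fun x => x + w) '' E) ∩ T) →
        inner ℝ v θ = inner ℝ w θ := by
  obtain ⟨R, hR⟩ := hb.exists_norm_le
  have hne : ∃ r, radonTransform E θ r ≠ 0 := by
    by_contra! h0
    have h1 := volume_inter_strip_eq_lintegral hE hθ MeasurableSet.univ
    have h2 : ∀ r, volume {s : ℝ | r • θ + s • perp θ ∈ E} = 0 := fun r =>
      ((ENNReal.toReal_eq_zero_iff _).1 (h0 r)).resolve_right (volume_section_ne_top hb hθ r)
    simp only [h2, mem_univ, lintegral_zero] at h1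
    exact hpos.ne' (measure_mono_null
      (show E ⊆ E ∩ {x | inner ℝ x θ ∈ (univ : Set ℝ)} from fun x hx => ⟨hx, trivial⟩) h1)
  obtain ⟨S, hS, hinj⟩ := hac.exists_injective_setIntegral
    (fun r hr => radonTransform_eq_zero_of_lt hR hθ hr) (fun r => ENNReal.toReal_nonneg) hne
  have hp : Measurable (fun x : Plane => (inner ℝ x θ : ℝ)) := by fun_prop
  refine ⟨{x | inner ℝ x θ ∈ S}, hp hS, fun v w hvw => hinj ?_⟩
  have h := congrArg ENNReal.toReal hvw
  rwa [toReal_volume_translate_inter_strip hb hE hθ hac.continuous.measurable hS,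
    toReal_volume_translate_inter_strip hb hE hθ hac.continuous.measurable hS] at h

/-! ### Choice of two orthogonal directions -/

theorem perp_injective : Function.Injective perp := by
  intro θ η h
  have h0 := congrArg (fun x : Plane => x 0) h
  have h1 := congrArg (fun x : Plane => x 1) h
  simp only [perp, PiLp.toLp_apply, Matrix.cons_val_zero, Matrix.cons_val_one, neg_inj] at h0 h1
  ext i
  fin_cases i
  · exact h1
  · exact h0

/-- A quarter circle is an injective image of `[0, 1]`, which is not a null set and so not
countable. -/
theorem exists_unit_vector_notMem {C : Set Plane} (hC : C.Countable) :
    ∃ θ : Plane, ‖θ‖ = 1 ∧ θ ∉ C := by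
  by_contra! h
  let u : ℝ → Plane := fun y => !₂[y, √(1 - y ^ 2)]
  have hu : Function.Injective u := fun y z hyz => by
    simpa [u] using congrArg (fun x : Plane => x 0) hyz
  have hsub : Icc (0 : ℝ) 1 ⊆ u ⁻¹' C := by
    intro y hy
    refine h _ ((norm_eq_one_iff_coords _).2 ?_)
    have : 0 ≤ 1 - y ^ 2 := by nlinarith [hy.1, hy.2]
    simp [u, Real.sq_sqrt this]
  have := ((hC.preimage hu).mono hsub).measure_zero volume
  simp at this

theorem eq_of_inner_eq_of_inner_perp_eq {θ v w : Plane} (hθ : ‖θ‖ = 1)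
    (h1 : (inner ℝ v θ : ℝ) = inner ℝ w θ)
    (h2 : (inner ℝ v (perp θ) : ℝ) = inner ℝ w (perp θ)) : v = w := by
  obtain ⟨s, hs⟩ := (inner_eq_iff_exists_perp θ hθ _ v).1 rfl
  obtain ⟨t, ht⟩ := (inner_eq_iff_exists_perp θ hθ _ w).1 rfl
  have hs' : inner ℝ v (perp θ) = s := by
    conv_lhs => rw [hs]
    exact inner_combination_right hθ _ _
  have ht' : inner ℝ w (perp θ) = t := by
    conv_lhs => rw [ht]
    exact inner_combination_right hθ _ _
  rw [hs, ht, ← hs', ← ht', h1, h2]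

theorem theoremt :
    (∀ K : Set Plane, IsCompact K → IsRectifiable (frontier K) →
      MeasureTheory.Measure.hausdorffMeasure 1 (frontier K) < ⊤ →
      Set.Countable {θ : Plane | ‖θ‖ = 1 ∧ ¬ IsAbsolutelyContinuous (radonTransform K θ)}) ∧
    (∀ E : Set Plane, Bornology.IsBounded E →
      MeasureTheory.NullMeasurableSet E MeasureTheory.volume →
      0 < MeasureTheory.volume E → IsRectifiable (frontier E) →
      MeasureTheory.Measure.hausdorffMeasure 1 (frontier E) < ⊤ →
      CanReconstruct (translates E) 2) := by
  refine ⟨fun K hK => countable_not_isAbsolutelyContinuous_radonTransform hK.isBounded,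
    fun E hb hE hpos hrect hfin => ?_⟩
  have hC := countable_not_isAbsolutelyContinuous_radonTransform hb hrect hfin
  -- Avoiding the preimage under `perp` as well makes both `θ` and `perp θ` good.
  obtain ⟨θ, hθ, hθC⟩ := exists_unit_vector_notMem (hC.union (hC.preimage perp_injective))
  have hac : IsAbsolutelyContinuous (radonTransform E θ) := by
    by_contra h
    exact hθC (Or.inl ⟨hθ, h⟩)
  have hθ' : ‖perp θ‖ = 1 := (norm_perp θ).trans hθ
  have hac' : IsAbsolutelyContinuous (radonTransform E (perp θ)) := by
    by_contra h
    exact hθC (Or.inr ⟨hθ', h⟩)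
  obtain ⟨T₁, hT₁, h₁⟩ := exists_test_set_of_isAbsolutelyContinuous hb hE hpos hθ hac
  obtain ⟨T₂, hT₂, h₂⟩ := exists_test_set_of_isAbsolutelyContinuous hb hE hpos hθ' hac'
  refine ⟨![T₁, T₂], fun i => ?_, ?_⟩
  · fin_cases i
    · exact hT₁.nullMeasurableSet
    · exact hT₂.nullMeasurableSet
  · rintro _ ⟨v, rfl⟩ _ ⟨w, rfl⟩ h
    rw [eq_of_inner_eq_of_inner_perp_eq hθ (h₁ v w (h 0)) (h₂ v w (h 1))]
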